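/- Let $\mathbb{T}_1$ and $\mathbb{T}_2$ be single-sorted equational theories over disjoint signatures $\Sigma_1$ and $\Sigma_2$ of finitary operation symbols. Suppose that for each $i\in\{1,2\}$ the signature $\Sigma_i$ contains a function symbol $f$ of some arity $k\ge 1$ that is neither a projection in $\mathbb{T}_i$ (i.e. for no $1\le j\le k$ does $\mathbb{T}_i$ prove $f(y_1,\dots,y_k)=y_j$, where $y_1,\dots,y_k$ are pairwise distinct variables) nor constant in $\mathbb{T}_i$ (i.e. for no term $s$ over $\Sigma_i$, closed or not, in which none of $y_1,\dots,y_k$ occurs, does $\mathbb{T}_i$ prove $f(y_1,\dots,y_k)=s$). Let $\mathbb{T}_1+\mathbb{T}_2$ be the equational theory over $\Sigma_1\cup\Sigma_2$ whose axioms are those of $\mathbb{T}_1$ together with those of $\mathbb{T}_2$, let $(\mathbb{T}_1+\mathbb{T}_2)\mathsf{mod}$ be the category of its set-based models and homomorphisms, let $n\ge 0$, and let $M_n$ be the free model of $\mathbb{T}_1+\mathbb{T}_2$ on $n$ generators. Let $\mathcal{Z}(M_n)$ be the covariant isotropy group of $M_n$, i.e. the group of natural automorphisms of the forgetful functor $M_n/(\mathbb{T}_1+\mathbb{T}_2)\mathsf{mod}\to(\mathbb{T}_1+\mathbb{T}_2)\mathsf{mod}$.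 Concretely, its elements are the families of automorphisms $\pi_h:\mathrm{cod}(h)\to\mathrm{cod}(h)$, indexed by the homomorphisms $h$ of models with domain $M_n$, such that $h'\circ\pi_h=\pi_{h'\circ h}\circ h'$ for all homomorphisms $h:M_n\to M'$ and $h':M'\to M''$ of models. Then: 1. For every (not necessarily natural) family $\pi=(\pi_h:\mathrm{cod}(h)\to\mathrm{cod}(h))_{\mathrm{dom}(h)=M_n}$ of endomorphisms in $(\mathbb{T}_1+\mathbb{T}_2)\mathsf{mod}$, indexed by the homomorphisms with domain $M_n$, one has $\pi\in\mathcal{Z}(M_n)$ if and only if $\pi_h=\mathrm{id}_M$ for every homomorphism $h:M_n\to M$ of models of $\mathbb{T}_1+\mathbb{T}_2$. 2. An automorphism $h:M_n\to M_n$ is a categorical inner automorphism (is coherently extendible), i.e. $h=\pi_{\mathrm{id}_{M_n}}$ for some $\pi\in\mathcal{Z}(M_n)$, if and only if $h=\mathrm{id}_{M_n}$. -/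

import Mathlib

open CategoryTheory FirstOrder

universe u v

namespace EquationalTheories

/-- A (single-sorted) equational theory over `L`: a set of equations between `L`-terms, whose
variables are drawn from the countably infinite set `ℕ`.  It is used for languages `L` that have
no relation symbols, i.e. for signatures of operation symbols of finite arity. -/
abbrev EqTheory (L : FirstOrder.Language.{u, v}) : Type u :=
  Set (L.Term ℕ × L.Term ℕ)

/-- `Proves T s t`: the equation `s = t` is derivable from the axioms of `T` in equational logic
(substitution instances of axioms, reflexivity, symmetry, transitivity, compatibility with the
function symbols).  The terms may contain the elements of `α` as variables. -/
inductive Proves {L : FirstOrder.Language.{u, v}} (T : EqTheory L) {α : Type} :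
    L.Term α → L.Term α → Prop
  | ax (e : L.Term ℕ × L.Term ℕ) (he : e ∈ T) (σ : ℕ → L.Term α) :
      Proves T (e.1.subst σ) (e.2.subst σ)
  | refl (t : L.Term α) : Proves T t t
  | symm {s t : L.Term α} : Proves T s t → Proves T t s
  | trans {s t r : L.Term α} : Proves T s t → Proves T t r → Proves T s r
  | congr {k : ℕ} (f : L.Functions k) (ts ss : Fin k → L.Term α) :
      (∀ i, Proves T (ts i) (ss i)) → Proves T (FirstOrder.Language.Term.func f ts) (FirstOrder.Language.Term.func f ss)

/-- The term `f(y₁, …, yₖ)` in the pairwise distinct variables `y₁, …, yₖ`. -/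
def genericTerm {L : FirstOrder.Language.{u, v}} {k : ℕ} (f : L.Functions k) : L.Term ℕ :=
  FirstOrder.Language.Term.func f (fun i : Fin k => FirstOrder.Language.Term.var (i : ℕ))

/-- `f` is a projection in `T`: `T` proves `f(y₁, …, yₖ) = yᵢ` for some `i`. -/
def IsProjectionIn {L : FirstOrder.Language.{u, v}} (T : EqTheory L) {k : ℕ} (f : L.Functions k) : Prop :=
  ∃ i : Fin k, Proves T (genericTerm f) (FirstOrder.Language.Term.var (i : ℕ))

/-- `f` is constant in `T`: `T` proves `f(y₁, …, yₖ) = s` for some (not necessarily closed)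
term `s` in which none of the variables `y₁, …, yₖ` occurs. -/
def IsConstantIn {L : FirstOrder.Language.{u, v}} (T : EqTheory L) {k : ℕ} (f : L.Functions k) : Prop :=
  ∃ s : L.Term ℕ, (∀ i : Fin k, (i : ℕ) ∉ s.varFinset) ∧ Proves T (genericTerm f) s

/-- The disjoint union `T₁ + T₂`: the theory over the disjoint union of the two signatures whose
axioms are those of `T₁` and those of `T₂`. -/
def EqTheory.sum {L₁ L₂ : FirstOrder.Language.{u, v}} (T₁ : EqTheory L₁) (T₂ : EqTheory L₂) :
    EqTheory (L₁.sum L₂) :=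
  (fun e => ((FirstOrder.Language.LHom.sumInl : L₁ →ᴸ L₁.sum L₂).onTerm e.1,
      (FirstOrder.Language.LHom.sumInl : L₁ →ᴸ L₁.sum L₂).onTerm e.2)) '' T₁ ∪
  (fun e => ((FirstOrder.Language.LHom.sumInr : L₂ →ᴸ L₁.sum L₂).onTerm e.1,
      (FirstOrder.Language.LHom.sumInr : L₂ →ᴸ L₁.sum L₂).onTerm e.2)) '' T₂

/-- A set-based model of `T`: a (possibly empty) set with an interpretation of the function
symbols that satisfies all axioms of `T`. -/
structure Model {L : FirstOrder.Language.{u, v}} (T : EqTheory L) where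
  carrier : Type u
  [str : L.Structure carrier]
  sat : ∀ e ∈ T, ∀ a : ℕ → carrier, e.1.realize a = e.2.realize a

attribute [instance] Model.str

/-- The category of models of `T` and homomorphisms between them. -/
instance Model.category {L : FirstOrder.Language.{u, v}} (T : EqTheory L) : Category.{u} (Model T) where
  Hom M N := M.carrier →[L] N.carrier
  id M := FirstOrder.Language.Hom.id L M.carrier
  comp f g := FirstOrder.Language.Hom.comp g f

/-- The model `M` is free on the family `y` of `n` generators. -/
def IsFreeOn {L : FirstOrder.Language.{u, v}} {T : EqTheory L} (M : Model T) {n : ℕ}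
    (y : Fin n → M.carrier) : Prop :=
  ∀ (N : Model T) (a : Fin n → N.carrier),
    ∃! h : M.carrier →[L] N.carrier, ∀ i, h (y i) = a i

/-- The covariant isotropy group of an object `M` of a category: the group of all natural
automorphisms of the forgetful functor from the category under `M`. -/
abbrev IsotropyGroup {C : Type*} [Category C] (M : C) : Type _ :=
  Aut (Under.forget M)

/-- A (not necessarily natural) family of endomorphisms `π h : cod h ⟶ cod h`, indexed by the
morphisms `h` with domain `M`. -/
abbrev EndoFamily {C : Type*} [Category C] (M : C) : Type _ :=
  ∀ ⦃N : C⦄, (M ⟶ N) → (N ⟶ N)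

/-- The family `π` is (the family of components of) an element of the isotropy group of `M`. -/
def EndoFamily.MemIsotropy {C : Type*} [Category C] {M : C} (π : EndoFamily M) : Prop :=
  ∃ α : IsotropyGroup M, ∀ ⦃N : C⦄ (h : M ⟶ N), α.hom.app (Under.mk h) = π h

/-- The automorphism `g` of `M` is a categorical inner automorphism (is coherently extendible):
it is the component at `𝟙 M` of an element of the isotropy group of `M`. -/
def IsCategoricalInner {C : Type*} [Category C] {M : C} (g : Aut M) : Prop :=
  ∃ α : IsotropyGroup M, α.hom.app (Under.mk (𝟙 M)) = g.hom

section FreeModel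

variable {L : FirstOrder.Language.{u, v}}

/-- Provable equality of terms in `n` generators. -/
def provesSetoid (T : EqTheory L) (n : ℕ) : Setoid (L.Term (Fin n)) where
  r := Proves T
  iseqv := ⟨Proves.refl, Proves.symm, Proves.trans⟩

/-- Terms in `n` generators modulo provable equality, as an algebra.  (Relation symbols, of which
there are none in the intended signatures, would be interpreted by the empty relation.) -/
noncomputable instance freeStructure (T : EqTheory L) (n : ℕ) :
    L.Structure (Quotient (provesSetoid T n)) where
  funMap f xs := Quotient.mk _ (FirstOrder.Language.Term.func f (fun i => (xs i).out))
  RelMap _ _ := False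

theorem freeStructure_funMap (T : EqTheory L) (n : ℕ) {k : ℕ} (f : L.Functions k)
    (ts : Fin k → L.Term (Fin n)) :
    FirstOrder.Language.Structure.funMap f (fun i => Quotient.mk (provesSetoid T n) (ts i)) =
      Quotient.mk (provesSetoid T n) (FirstOrder.Language.Term.func f ts) :=
  Quotient.sound (Proves.congr f _ _ fun i => Quotient.mk_out (s := provesSetoid T n) (ts i))

theorem realize_mk (T : EqTheory L) (n : ℕ) {α : Type} (t : L.Term α) (σ : α → L.Term (Fin n)) :
    t.realize (fun j => Quotient.mk (provesSetoid T n) (σ j)) =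
      Quotient.mk (provesSetoid T n) (t.subst σ) := by
  induction t with
  | var j => rfl
  | func f ts ih =>
    simp only [FirstOrder.Language.Term.realize_func, ih, FirstOrder.Language.Term.subst]
    exact freeStructure_funMap T n f _

/-- The explicit free model: terms in the generators modulo provable equality. -/
noncomputable def freeModel (T : EqTheory L) (n : ℕ) : Model T where
  carrier := Quotient (provesSetoid T n)
  sat e he a := by
    have ha : a = fun j => Quotient.mk (provesSetoid T n) (a j).out := by
      funext j; exact (Quotient.out_eq _).symm
    rw [ha, realize_mk, realize_mk]
    exact Quotient.sound (Proves.ax e he _)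

theorem Proves.sound {T : EqTheory L} {α : Type} {s t : L.Term α} (h : Proves T s t) (N : Model T)
    (a : α → N.carrier) : s.realize a = t.realize a := by
  induction h with
  | ax e he σ =>
    rw [FirstOrder.Language.Term.realize_subst, FirstOrder.Language.Term.realize_subst]
    exact N.sat e he _
  | refl t => rfl
  | symm _ ih => exact ih.symm
  | trans _ _ ih₁ ih₂ => exact ih₁.trans ih₂
  | congr f ts ss _ ih => simp only [FirstOrder.Language.Term.realize_func, ih]

/-- The explicit free model has the universal property, so free models exist. -/
theorem freeModel_isFreeOn (T : EqTheory L) (n : ℕ) :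
    IsFreeOn (freeModel T n)
      (fun i => Quotient.mk (provesSetoid T n) (FirstOrder.Language.Term.var i)) := by
  intro N a
  refine ⟨⟨Quotient.lift (fun t : L.Term (Fin n) => t.realize a)
    (fun _ _ h => Proves.sound h N a), ?_, ?_⟩, fun i => rfl, ?_⟩
  · intro k f xs
    obtain ⟨ts, rfl⟩ : ∃ ts : Fin k → L.Term (Fin n),
        xs = fun i => Quotient.mk (provesSetoid T n) (ts i) :=
      ⟨fun i => (xs i).out, funext fun i => (Quotient.out_eq (xs i)).symm⟩
    exact congrArg (Quotient.lift (fun t : L.Term (Fin n) => t.realize a)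
      (fun _ _ h => Proves.sound h N a)) (freeStructure_funMap T n f ts)
  · exact fun r x h => h.elim
  · intro g hg
    ext x
    induction x using Quotient.inductionOn with
    | h t =>
      induction t with
      | var i => exact hg i
      | func f ts ih =>
        have h1 := freeStructure_funMap T n f ts
        have h2 := g.map_fun f (fun i => Quotient.mk (provesSetoid T n) (ts i))
        refine (congrArg g h1.symm).trans (h2.trans ?_)
        exact congrArg (FirstOrder.Language.Structure.funMap f) (funext ih)

end FreeModel

end EquationalTheories

/-!
The theorem holds because a free model of `T₁ + T₂` decomposes into alternating layers of
`T₁`-operations and `T₂`-operations, and an element of the isotropy group, which acts on a generic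
element `x` as substitution into one fixed element `p x`, has to commute with the operations of both
theories.

The layers are made available by a concrete free model `N` of `T₁ + T₂` (`exists_isBilayered`).
Its elements have a rank, the number of layers.  Those of rank zero are the free generators; an
element of positive rank has an outermost layer, belonging to `T₁` or to `T₂`.  As a model of `T₁`,
`N` is free on the elements whose outermost layer does not belong to `T₁`, and likewise for `T₂`
(`IsLayered`).  Such structures exist for reasons of cardinality only: the non-generators of rank
`m` in a free model are as many as the elements of `N` reserved for them, so that a bijection
transports the structure.  Recursion on the rank extends any assignment on the elements of rank zero
to a homomorphism (`IsBilayered.exists_hom`).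

Let `p` be the component at `N` of an element of the isotropy group.  It is an automorphism that
commutes with the endomorphisms of `N` that fix the images of the generators of `M`.  Suppose that
the outermost layer of `p x` belongs to `T₂`, and let `f` be an operation of `T₁` that is neither
constant nor a projection.  Then `f (p x₀, …, p xₖ₋₁)` has one more layer than `p x`, and that layer
belongs to `T₁`, since the `p xᵢ` are distinct generators for `T₁` (`IsLayered.lt_rank_funMap`).  But
it equals `p (f (x₀, …, xₖ₋₁))`, which arises from `p x` by substituting for `x` an element with at
most one layer; such a substitution adds at most one layer in total, and none if it changes the type
of the outermost one (`IsBilayered.rank_map_le`, `IsBilayered.rank_map_lt`).  This contradiction is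
`IsBilayered.map_notMem`.  By symmetry `p x` has rank zero, and then `p x = x` because `p` is
injective (`IsBilayered.map_eq`).  Every element of every model under `M` is the image of such an `x`,
so naturality makes all components identities.
-/

open CategoryTheory FirstOrder

namespace EquationalTheories

open FirstOrder.Language (Term LHom)
open FirstOrder.Language.Structure (funMap)

/-! ### Equality in all models -/

section Semantic

variable {L : FirstOrder.Language.{u, v}} {T : EqTheory L}

/-- `SemEq T s t`: the equation `s = t` holds in every model of `T`.  Unlike `Proves`, this makes
sense for variables from an arbitrary universe. -/
def SemEq (T : EqTheory L) {α : Type*} (s t : L.Term α) : Prop :=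
  ∀ (N : Model T) (a : α → N.carrier), s.realize a = t.realize a

theorem SemEq.relabel {α β : Type*} {s t : L.Term α} (h : SemEq T s t) (σ : α → β) :
    SemEq T (s.relabel σ) (t.relabel σ) := fun N a => by
  rw [Term.realize_relabel, Term.realize_relabel]
  exact h N _

/-- A congruence on the term algebra over `α` that contains all substitution instances of the
axioms of `T`. -/
structure TermCongruence (T : EqTheory L) (α : Type u) extends Setoid (L.Term α) where
  func : ∀ {k : ℕ} (f : L.Functions k) (ts ss : Fin k → L.Term α),
    (∀ i, r (ts i) (ss i)) → r (Term.func f ts) (Term.func f ss)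
  ax : ∀ e ∈ T, ∀ σ : ℕ → L.Term α, r (e.1.subst σ) (e.2.subst σ)

namespace TermCongruence

variable {α : Type u} (c : TermCongruence T α)

/-- Operations act on classes of terms; relation symbols, absent from the intended signatures,
are interpreted by the empty relation. -/
noncomputable instance quotientStructure : L.Structure (Quotient c.toSetoid) where
  funMap f xs := Quotient.mk _ (Term.func f fun i => (xs i).out)
  RelMap _ _ := False

theorem realize_mk {β : Type*} (t : L.Term β) (σ : β → L.Term α) :
    t.realize (fun j => Quotient.mk c.toSetoid (σ j)) = Quotient.mk c.toSetoid (t.subst σ) := by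
  induction t with
  | var j => rfl
  | func f ts ih =>
    simp only [Term.realize_func, ih, Term.subst]
    exact Quotient.sound (c.func f _ _ fun i => Quotient.mk_out (s := c.toSetoid) _)

/-- The quotient of the term algebra by a congruence that contains the axioms. -/
noncomputable def model : Model T where
  carrier := Quotient c.toSetoid
  sat e he a := by
    obtain ⟨σ, rfl⟩ : ∃ σ : ℕ → L.Term α, a = fun j => Quotient.mk c.toSetoid (σ j) :=
      ⟨fun j => (a j).out, funext fun j => (Quotient.out_eq (a j)).symm⟩
    rw [realize_mk, realize_mk]
    exact Quotient.sound (c.ax e he σ)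

end TermCongruence

theorem relabel_subst {α β γ : Type*} (t : L.Term α) (σ : α → L.Term β) (g : β → γ) :
    (t.subst σ).relabel g = t.subst fun i => (σ i).relabel g := by
  induction t with
  | var _ => rfl
  | func f ts ih => simp only [Term.subst, Term.relabel, ih]

theorem subst_var {α : Type*} (t : L.Term α) : t.subst Term.var = t := by
  induction t with
  | var _ => rfl
  | func f ts ih => simp only [Term.subst, ih]

theorem subst_var_comp {α β : Type*} (t : L.Term α) (g : α → β) :
    t.subst (fun i => Term.var (g i)) = t.relabel g := by
  induction t with
  | var _ => rfl
  | func f ts ih => simp only [Term.subst, Term.relabel, ih]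

/-- Provable equality, for variables lifted to the universe of the models. -/
def provesCongruence (T : EqTheory L) : TermCongruence T (ULift.{u} ℕ) where
  r s t := Proves T (s.relabel ULift.down) (t.relabel ULift.down)
  iseqv := ⟨fun _ => Proves.refl _, Proves.symm, Proves.trans⟩
  func f _ _ h := Proves.congr f _ _ h
  ax e he σ := by
    rw [relabel_subst, relabel_subst]
    exact Proves.ax e he _

/-- Completeness of equational logic. -/
theorem SemEq.proves {s t : L.Term ℕ} (h : SemEq T s t) : Proves T s t := by
  have h1 := h (provesCongruence T).model
    fun j => Quotient.mk (provesCongruence T).toSetoid (Term.var (ULift.up j))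
  have h2 := ((provesCongruence T).realize_mk s _).symm.trans
    (h1.trans ((provesCongruence T).realize_mk t _))
  have h3 : Proves T _ _ := Quotient.exact h2
  rw [subst_var_comp, subst_var_comp, Term.relabel_relabel, Term.relabel_relabel] at h3
  have hid : (ULift.down ∘ fun j : ℕ => (ULift.up.{u} j)) = id := rfl
  rwa [hid, Term.relabel_id, Term.relabel_id] at h3

/-- Equality in all models, whose quotient is the free model on `α`. -/
def semCongruence (T : EqTheory L) (α : Type u) : TermCongruence T α where
  r := SemEq T
  iseqv := ⟨fun _ _ _ => rfl, fun h N a => (h N a).symm, fun h h' N a => (h N a).trans (h' N a)⟩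
  func f ts ss h N a := by
    simp only [Term.realize_func]
    exact congrArg _ (funext fun i => h i N a)
  ax e he σ N a := by
    rw [Term.realize_subst, Term.realize_subst]
    exact N.sat e he _

variable {k : ℕ} {f : L.Functions k}

/-- A non-constant operation, applied to distinct variables, is not expressible by a term in other
variables `ι`. -/
theorem not_semEq_of_not_isConstantIn (hc : ¬ IsConstantIn T f) {α ι : Type*} {z : Fin k → α}
    (hz : Function.Injective z) (s : L.Term ι) (v : ι → α) (hv : ∀ j i, v j ≠ z i) :
    ¬ SemEq T (Term.func f fun i => Term.var (z i)) (s.relabel v) := by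
  classical
  intro h
  -- Rename `z i` to the variable `i` and everything else to the variable `k`.
  let σ : α → ℕ := Function.extend z (fun i => (i : ℕ)) fun _ => k
  have hσ : σ ∘ v = fun _ => k := by
    funext j
    exact (Function.extend_apply' (fun i : Fin k => (i : ℕ)) (fun _ => k) (v j)
      fun ⟨i, hi⟩ => hv j i hi.symm :)
  refine hc ⟨(s.relabel v).relabel σ, fun i hi => ?_, SemEq.proves ?_⟩
  · have key : ∀ t : L.Term ι, ∀ m ∈ (t.relabel (σ ∘ v)).varFinset, m = k := by
      intro t
      rw [hσ]
      induction t with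
      | var j => intro m hm; simpa [Term.relabel] using hm
      | func g ts ih =>
        intro m hm
        simp only [Term.relabel, Term.varFinset, Finset.mem_biUnion] at hm
        obtain ⟨j, -, hj⟩ := hm
        exact ih j m hj
    rw [Term.relabel_relabel] at hi
    exact i.2.ne (key s _ hi)
  · convert h.relabel σ using 1
    simp only [genericTerm, Term.relabel]
    congr 1
    funext i
    exact congrArg _ (hz.extend_apply _ _ i).symm

/-- A non-constant operation that is not a projection, applied to distinct variables, is not equal
to a variable. -/
theorem not_semEq_var (hc : ¬ IsConstantIn T f) (hp : ¬ IsProjectionIn T f) {α : Type*}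
    {z : Fin k → α} (hz : Function.Injective z) (w : α) :
    ¬ SemEq T (Term.func f fun i => Term.var (z i)) (Term.var w) := by
  classical
  intro h
  by_cases hw : ∃ i, z i = w
  · obtain ⟨i, rfl⟩ := hw
    refine hp ⟨i, SemEq.proves ?_⟩
    have h1 := h.relabel (Function.extend z (fun i => (i : ℕ)) fun _ => k)
    simpa only [genericTerm, Term.relabel, hz.extend_apply] using h1
  · exact not_semEq_of_not_isConstantIn hc hz (Term.var ()) (fun _ => w)
      (fun _ i hi => hw ⟨i, hi.symm⟩) h

/-- If a variable equals a term in other variables in all models, then all models have at most one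
element, so every operation is constant. -/
theorem not_semEq_var_relabel (hc : ¬ IsConstantIn T f) {α ι : Type*} (w : α) (s : L.Term ι)
    (v : ι → α) (hv : ∀ j, v j ≠ w) : ¬ SemEq T (Term.var w) (s.relabel v) := by
  classical
  intro h
  refine not_semEq_of_not_isConstantIn hc (z := fun i : Fin k => (i : ℕ))
    Fin.val_injective (Term.var ()) (fun _ => k) (fun _ i hi => i.2.ne hi.symm) ?_
  have hsub : ∀ (N : Model T) (a b : N.carrier), a = b := by
    intro N a b
    have h1 := h N (Function.update (fun _ => b) w a)
    have h2 := h N fun _ => b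
    have h3 : Function.update (fun _ => b) w a ∘ v = (fun _ => b) ∘ v :=
      funext fun j => Function.update_of_ne (hv j) _ _
    rw [Term.realize_relabel] at h1 h2
    rw [h3, ← h2] at h1
    simpa using h1
  exact fun N a => hsub N _ _

end Semantic

/-! ### Free models on arbitrary sets -/

section FreeAlgebra

variable {L : FirstOrder.Language.{u, v}} (T : EqTheory L) (α : Type u)

/-- The underlying set of the free model of `T` on an arbitrary set `α`. -/
abbrev Free : Type u := (semCongruence T α).model.carrier

variable {α}

/-- The class of a term in the free model. -/
def Free.mk (s : L.Term α) : Free T α := Quotient.mk (semCongruence T α).toSetoid s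

variable {T}

theorem Free.mk_eq_mk {s t : L.Term α} : Free.mk T s = Free.mk T t ↔ SemEq T s t :=
  Quotient.eq (r := (semCongruence T α).toSetoid)

theorem Free.exists_mk (a : Free T α) : ∃ s : L.Term α, Free.mk T s = a :=
  Quotient.exists_rep (s := (semCongruence T α).toSetoid) a

theorem Free.realize_mk {β : Type*} (t : L.Term β) (σ : β → L.Term α) :
    t.realize (fun j => Free.mk T (σ j)) = Free.mk T (t.subst σ) :=
  (semCongruence T α).realize_mk t σ

theorem Free.realize_var (t : L.Term α) :
    t.realize (fun j => Free.mk T (Term.var j)) = Free.mk T t := by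
  rw [Free.realize_mk, subst_var]

theorem Free.funMap_mk {k : ℕ} (f : L.Functions k) (ts : Fin k → L.Term α) :
    funMap f (fun i => Free.mk T (ts i)) = Free.mk T (Term.func f ts) := by
  have h := Free.realize_mk (T := T) (Term.func f fun i => Term.var i) ts
  simpa only [Term.realize_func, Term.realize_var, Term.subst] using h

variable (T) (ρ : α → ℕ)

/-- The elements of the free model that are values of terms in generators of rank at most `m`. -/
def Free.span (m : ℕ) : Set (Free T α) :=
  {a | ∃ s : L.Term {g : α // ρ g ≤ m}, Free.mk T (s.relabel Subtype.val) = a}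

variable {T ρ}

theorem Free.span_mono {m m' : ℕ} (h : m ≤ m') : Free.span T ρ m ⊆ Free.span T ρ m' := by
  rintro a ⟨s, rfl⟩
  exact ⟨s.relabel fun g => ⟨g.1, g.2.trans h⟩, by rw [Term.relabel_relabel]; rfl⟩

theorem Free.funMap_mem_span {m k : ℕ} (f : L.Functions k) (xs : Fin k → Free T α)
    (h : ∀ i, xs i ∈ Free.span T ρ m) : funMap f xs ∈ Free.span T ρ m := by
  choose s hs using h
  obtain rfl : (fun i => Free.mk T ((s i).relabel Subtype.val)) = xs := funext hs
  exact ⟨Term.func f s, (Free.funMap_mk f _).symm⟩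

variable (ρ) in
theorem Free.exists_mem_span (a : Free T α) : ∃ m, a ∈ Free.span T ρ m := by
  obtain ⟨s, rfl⟩ := Free.exists_mk a
  induction s with
  | var g => exact ⟨ρ g, Term.var ⟨g, le_rfl⟩, rfl⟩
  | func f ts ih =>
    choose m hm using ih
    refine ⟨Finset.univ.sup m, ?_⟩
    rw [← Free.funMap_mk]
    exact Free.funMap_mem_span f _ fun i =>
      Free.span_mono (Finset.le_sup (f := m) (Finset.mem_univ i)) (hm i)

open Classical in
variable (ρ) in
/-- The least rank of generators that suffice to express an element of the free model. -/
noncomputable def Free.rank (a : Free T α) : ℕ := Nat.find (Free.exists_mem_span ρ a)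

theorem Free.rank_le_iff {a : Free T α} {m : ℕ} : Free.rank ρ a ≤ m ↔ a ∈ Free.span T ρ m := by
  classical
  refine ⟨fun h => Free.span_mono h (Nat.find_spec (Free.exists_mem_span ρ a)), fun h => ?_⟩
  exact Nat.find_min' _ h

variable {k : ℕ} {f : L.Functions k}

theorem Free.rank_var (hc : ¬ IsConstantIn T f) (g : α) :
    Free.rank ρ (Free.mk T (Term.var g)) = ρ g := by
  refine le_antisymm (Free.rank_le_iff.2 ⟨Term.var ⟨g, le_rfl⟩, rfl⟩) ?_
  obtain ⟨s, hs⟩ := Free.rank_le_iff.1 (le_refl (Free.rank ρ (Free.mk T (Term.var g))))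
  by_contra hlt
  exact not_semEq_var_relabel hc g s Subtype.val
    (fun j hj => hlt (le_of_eq_of_le (congrArg ρ hj.symm) j.2)) (Free.mk_eq_mk.1 hs.symm)

theorem Free.var_injective (hc : ¬ IsConstantIn T f) :
    Function.Injective fun g : α => Free.mk T (Term.var g) := by
  intro g g' h
  by_contra hne
  exact not_semEq_var_relabel hc g (Term.var ()) (fun _ => g') (fun _ h' => hne h'.symm)
    (Free.mk_eq_mk.1 h)

variable (T) in
/-- The generators of the free model. -/
def Free.gens (α : Type u) : Set (Free T α) := Set.range fun g : α => Free.mk T (Term.var g)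

/-- If `f` is neither constant nor a projection, then each rank with sufficiently many generators
is the rank of as many non-generators: the values of `f` at pairwise disjoint tuples. -/
theorem Free.card_nongens (hc : ¬ IsConstantIn T f) (hp : ¬ IsProjectionIn T f) {K : Type u}
    [Infinite K] (m : ℕ) (hK : Cardinal.mk K ≤ Cardinal.mk {g : α // ρ g = m})
    (hα : Cardinal.mk (Free T α) ≤ Cardinal.mk K) :
    Cardinal.mk {a : ↥(Free.gens T α)ᶜ // Free.rank ρ a.1 = m} = Cardinal.mk K := by
  refine le_antisymm ?_ ?_
  · exact (Cardinal.mk_subtype_le _).trans ((Cardinal.mk_subtype_le _).trans hα)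
  have h1 : Cardinal.mk (K × ULift.{u} (Fin k)) ≤ Cardinal.mk {g : α // ρ g = m} := by
    refine le_trans ?_ hK
    rw [Cardinal.mk_prod, Cardinal.lift_id, Cardinal.lift_id]
    refine (Cardinal.mul_le_max_of_aleph0_le_left (Cardinal.aleph0_le_mk K)).trans ?_
    exact max_le le_rfl ((Cardinal.mk_le_aleph0).trans (Cardinal.aleph0_le_mk K))
  obtain ⟨z⟩ := h1
  let tm : K → L.Term α := fun c => Term.func f fun i => Term.var (z (c, ⟨i⟩)).1
  have hz : ∀ c, Function.Injective fun i : Fin k => (z (c, ⟨i⟩)).1 := by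
    intro c i j hij
    simpa using z.injective (Subtype.ext hij)
  have hgen : ∀ c, Free.mk T (tm c) ∈ (Free.gens T α)ᶜ := by
    rintro c ⟨w, hw⟩
    exact not_semEq_var hc hp (hz c) w (Free.mk_eq_mk.1 hw.symm)
  have hrank : ∀ c, Free.rank ρ (Free.mk T (tm c)) = m := by
    intro c
    refine le_antisymm (Free.rank_le_iff.2 ?_) ?_
    · exact ⟨Term.func f fun i => Term.var ⟨(z (c, ⟨i⟩)).1, (z (c, ⟨i⟩)).2.le⟩, rfl⟩
    · obtain ⟨s, hs⟩ := Free.rank_le_iff.1 (le_refl (Free.rank ρ (Free.mk T (tm c))))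
      by_contra hlt
      refine not_semEq_of_not_isConstantIn hc (hz c) s Subtype.val (fun j i hj => hlt ?_)
        (Free.mk_eq_mk.1 hs.symm)
      have := j.2
      rwa [hj, (z (c, ⟨i⟩)).2] at this
  refine Cardinal.mk_le_of_injective (f := fun c => ⟨⟨_, hgen c⟩, hrank c⟩) fun c d hcd => ?_
  have hcd' : Free.mk T (tm c) = Free.mk T (tm d) := congrArg (fun a => a.1.1) hcd
  by_contra hne
  refine not_semEq_of_not_isConstantIn hc (hz c) (Term.func f fun i => Term.var i)
    (fun i => (z (d, ⟨i⟩)).1) (fun j i h => hne ?_) (Free.mk_eq_mk.1 hcd')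
  exact (congrArg Prod.fst (z.injective (Subtype.ext h))).symm

end FreeAlgebra

/-! ### Free models with a prescribed rank function -/

section Layered

/-- `IsLayered T A ρ`: a structure on `N` is a free model of `T` on the complement of `A`, in a way
compatible with the rank `ρ`.  The elements of `A` are the non-generators; the rank of such an
element is one more than the largest rank of a generator needed to express it, and it is one if no
generator is needed.  This is encoded by `exists_term` together with `funMap_mem`, which says that
the elements expressible by generators of rank at most `m` have rank at most `m + 1` if they lie in
`A`, and at most `m` otherwise. -/
structure IsLayered {L : FirstOrder.Language.{u, v}} (T : EqTheory L) {N : Type u} [L.Structure N]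
    (A : Set N) (ρ : N → ℕ) : Prop where
  sat : ∀ e ∈ T, ∀ a : ℕ → N, e.1.realize a = e.2.realize a
  exists_term : ∀ a ∈ A, ∃ s : L.Term {z : N // z ∉ A ∧ ρ z < ρ a}, s.realize Subtype.val = a
  funMap_mem : ∀ (m : ℕ) {k : ℕ} (f : L.Functions k) (xs : Fin k → N),
    (∀ i, (xs i ∈ A → ρ (xs i) ≤ m + 1) ∧ (xs i ∉ A → ρ (xs i) ≤ m)) →
    (funMap f xs ∈ A → ρ (funMap f xs) ≤ m + 1) ∧ (funMap f xs ∉ A → ρ (funMap f xs) ≤ m)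
  semEq : ∀ s t : L.Term {z : N // z ∉ A}, s.realize Subtype.val = t.realize Subtype.val →
    SemEq T s t

variable {L : FirstOrder.Language.{u, v}} {T : EqTheory L} {N : Type u}

/-- A bijection from a free model that restricts to the inclusion on generators and raises the rank
of the other elements by one transports the structure to a layered one. -/
theorem isLayered_of_equiv {A : Set N} {ρ : N → ℕ} {k : ℕ} {f : L.Functions k}
    (hc : ¬ IsConstantIn T f)
    (e : Free T {z : N // z ∉ A} ≃ N) (hgen : ∀ g, e (Free.mk T (Term.var g)) = g.1)
    (hA : ∀ a ∉ Free.gens T {z : N // z ∉ A}, e a ∈ A ∧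
      ρ (e a) = Free.rank (fun g : {z : N // z ∉ A} => ρ g.1) a + 1) :
    ∃ _ : L.Structure N, IsLayered T A ρ := by
  let _ : L.Structure N := e.inducedStructure
  let E : Free T {z : N // z ∉ A} ≃[L] N := e.inducedStructureEquiv
  have hE : ∀ a, E a = e a := fun _ => rfl
  have hreal : ∀ s : L.Term {z : N // z ∉ A}, s.realize Subtype.val = e (Free.mk T s) := by
    intro s
    rw [← Free.realize_var s, ← hE, ← Language.HomClass.realize_term]
    congr 1
    funext g
    exact (hgen g).symm
  have hmem : ∀ a, e a ∈ A ↔ a ∉ Free.gens T {z : N // z ∉ A} := by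
    refine fun a => ⟨?_, fun h => (hA a h).1⟩
    rintro h ⟨g, rfl⟩
    exact g.2 (hgen g ▸ h)
  have hspan : ∀ m a, ((e a ∈ A → ρ (e a) ≤ m + 1) ∧ (e a ∉ A → ρ (e a) ≤ m)) ↔
      a ∈ Free.span T (fun g : {z : N // z ∉ A} => ρ g.1) m := by
    intro m a
    rw [← Free.rank_le_iff]
    by_cases ha : a ∈ Free.gens T {z : N // z ∉ A}
    · obtain ⟨g, rfl⟩ := ha
      have h1 : ρ (e (Free.mk T (Term.var g))) =
          Free.rank (fun g : {z : N // z ∉ A} => ρ g.1) (Free.mk T (Term.var g)) := by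
        rw [Free.rank_var hc, hgen]
      have h2 : e (Free.mk T (Term.var g)) ∉ A := by rw [hgen]; exact g.2
      simp only [h1, h2, false_imp_iff, true_and, not_false_iff, true_imp_iff]
    · simp only [hA a ha, true_imp_iff, not_true, false_imp_iff, and_true, Nat.add_le_add_iff_right]
  refine ⟨inferInstance, ?_, ?_, ?_, ?_⟩
  · intro s hs a
    obtain ⟨b, rfl⟩ : ∃ b : ℕ → Free T {z : N // z ∉ A}, a = E ∘ b :=
      ⟨E.symm ∘ a, funext fun j => (E.apply_symm_apply (a j)).symm⟩
    rw [Language.HomClass.realize_term, Language.HomClass.realize_term]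
    exact congrArg _ ((semCongruence T _).model.sat s hs _)
  · intro a ha
    obtain ⟨b, rfl⟩ := e.surjective a
    have hr := (hA b ((hmem b).1 ha)).2
    obtain ⟨s, hs⟩ := Free.rank_le_iff.1
      (le_refl (Free.rank (fun g : {z : N // z ∉ A} => ρ g.1) b))
    refine ⟨s.relabel fun g => ⟨g.1.1, g.1.2, by rw [hr]; exact Nat.lt_succ_of_le g.2⟩, ?_⟩
    have h1 := hreal (s.relabel Subtype.val)
    rw [Term.realize_relabel] at h1 ⊢
    exact h1.trans (congrArg e hs)
  · intro m k f xs h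
    obtain ⟨ys, rfl⟩ : ∃ ys : Fin k → Free T {z : N // z ∉ A}, xs = E ∘ ys :=
      ⟨E.symm ∘ xs, funext fun j => (E.apply_symm_apply (xs j)).symm⟩
    rw [← Language.HomClass.map_fun]
    exact (hspan m _).2 (Free.funMap_mem_span f ys fun i => (hspan m _).1 (h i))
  · intro s t h
    rw [hreal, hreal] at h
    exact Free.mk_eq_mk.1 (e.injective h)

/-- Two maps to `ι` whose fibres have equal cardinalities differ by a bijection. -/
theorem exists_equiv_of_fibers {α β : Type u} {ι : Type*} (p : α → ι) (q : β → ι)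
    (h : ∀ i, Cardinal.mk {a // p a = i} = Cardinal.mk {b // q b = i}) :
    ∃ e : α ≃ β, ∀ a, q (e a) = p a := by
  have e : ∀ i, {a // p a = i} ≃ {b // q b = i} := fun i => (Cardinal.eq.1 (h i)).some
  let E : α ≃ β := (Equiv.sigmaFiberEquiv p).symm.trans
    ((Equiv.sigmaCongrRight e).trans (Equiv.sigmaFiberEquiv q))
  exact ⟨E, fun a => (e (p a) ⟨a, rfl⟩).2⟩

/-- A set all of whose layers have the cardinality of `K` carries a layered structure. -/
theorem exists_isLayered {k : ℕ} {f : L.Functions k} (hc : ¬ IsConstantIn T f)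
    (hp : ¬ IsProjectionIn T f) {K : Type u} [Infinite K] {A : Set N} {ρ : N → ℕ}
    (hL : Cardinal.mk (Σ l, L.Functions l) ≤ Cardinal.mk K)
    (hN : Cardinal.mk N ≤ Cardinal.mk K) (h0 : ∀ a ∈ A, ρ a ≠ 0)
    (hG : ∀ m, Cardinal.mk K ≤ Cardinal.mk {z : N // z ∉ A ∧ ρ z = m})
    (hA : ∀ m, Cardinal.mk K ≤ Cardinal.mk {z : N // z ∈ A ∧ ρ z = m + 1}) :
    ∃ _ : L.Structure N, IsLayered T A ρ := by
  classical
  let G := {z : N // z ∉ A}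
  have hF : Cardinal.mk (Free T G) ≤ Cardinal.mk K := by
    refine Cardinal.mk_quotient_le.trans (Term.card_le.trans (max_le (Cardinal.aleph0_le_mk K) ?_))
    rw [Cardinal.mk_sum, Cardinal.lift_id, Cardinal.lift_id]
    exact Cardinal.add_le_of_le (Cardinal.aleph0_le_mk K)
      ((Cardinal.mk_subtype_le _).trans hN) hL
  obtain ⟨e', he'⟩ := exists_equiv_of_fibers
    (fun a : ↥(Free.gens T G)ᶜ => Free.rank (fun g : G => ρ g.1) a.1)
    (fun b : A => ρ b.1 - 1) fun m => by
      rw [Free.card_nongens hc hp (K := K) m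
        ((hG m).trans (Cardinal.mk_congr (Equiv.subtypeSubtypeEquivSubtypeInter _ _)).symm.le) hF]
      refine le_antisymm ((hA m).trans ?_) ((Cardinal.mk_subtype_le _).trans
        ((Cardinal.mk_subtype_le _).trans hN))
      exact Cardinal.mk_le_of_injective (f := fun z => ⟨⟨z.1, z.2.1⟩, by simp [z.2.2]⟩)
        fun z z' h => Subtype.ext (congrArg (fun x => x.1.1) h)
  let e₀ : G ≃ Free.gens T G := Equiv.ofInjective _ (Free.var_injective hc)
  let e : Free T G ≃ N := (Equiv.Set.sumCompl (Free.gens T G)).symm.trans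
    ((Equiv.sumCongr e₀.symm e').trans ((Equiv.sumComm _ _).trans (Equiv.Set.sumCompl A)))
  refine isLayered_of_equiv hc e (fun g => ?_) fun a ha => ?_
  · have hg : Free.mk T (Term.var g) ∈ Free.gens T G := ⟨g, rfl⟩
    have h1 : e₀.symm ⟨_, hg⟩ = g := e₀.symm_apply_apply g
    simp only [e, Equiv.trans_apply, Equiv.Set.sumCompl_symm_apply_of_mem hg]
    exact congrArg Subtype.val h1
  · have h1 : e a = (e' ⟨a, ha⟩).1 := by
      have h2 := Equiv.Set.sumCompl_symm_apply_of_notMem (s := Free.gens T G) ha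
      simp only [e, Equiv.trans_apply]
      rw [h2]
      rfl
    rw [h1]
    have h2 := he' ⟨a, ha⟩
    have h3 := h0 _ (e' ⟨a, ha⟩).2
    exact ⟨(e' ⟨a, ha⟩).2, (by omega : ρ (e' ⟨a, ha⟩).1 = ρ (e' ⟨a, ha⟩).1 - 1 + 1).trans (congrArg (· + 1) h2)⟩

end Layered

/-! ### Models of the sum -/

section Sum

variable {L₁ L₂ : FirstOrder.Language.{u, v}} {T₁ : EqTheory L₁} {T₂ : EqTheory L₂}

/-- A set with structures satisfying `T₁` and `T₂` is a model of the sum. -/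
def sumModel {N : Type u} [L₁.Structure N] [L₂.Structure N]
    (h₁ : ∀ e ∈ T₁, ∀ a : ℕ → N, e.1.realize a = e.2.realize a)
    (h₂ : ∀ e ∈ T₂, ∀ a : ℕ → N, e.1.realize a = e.2.realize a) : Model (EqTheory.sum T₁ T₂) where
  carrier := N
  sat := by
    rintro _ (⟨e, he, rfl⟩ | ⟨e, he, rfl⟩) a
    · simpa only [LHom.realize_onTerm] using h₁ e he a
    · simpa only [LHom.realize_onTerm] using h₂ e he a

theorem Model.sat_left (P : Model (EqTheory.sum T₁ T₂)) [L₁.Structure P.carrier]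
    [(LHom.sumInl : L₁ →ᴸ L₁.sum L₂).IsExpansionOn P.carrier] :
    ∀ e ∈ T₁, ∀ a : ℕ → P.carrier, e.1.realize a = e.2.realize a := fun e he a => by
  simpa only [LHom.realize_onTerm] using P.sat _ (Or.inl ⟨e, he, rfl⟩) a

theorem Model.sat_right (P : Model (EqTheory.sum T₁ T₂)) [L₂.Structure P.carrier]
    [(LHom.sumInr : L₂ →ᴸ L₁.sum L₂).IsExpansionOn P.carrier] :
    ∀ e ∈ T₂, ∀ a : ℕ → P.carrier, e.1.realize a = e.2.realize a := fun e he a => by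
  simpa only [LHom.realize_onTerm] using P.sat _ (Or.inr ⟨e, he, rfl⟩) a

end Sum

/-! ### Homomorphisms and ranks in a layered structure -/

section Layered

variable {L : FirstOrder.Language.{u, v}} {T : EqTheory L} {N : Type u} [L.Structure N]
  {A : Set N} {ρ : N → ℕ}

/-- A map out of a layered structure that respects the chosen expressions of the elements of `A`
is a homomorphism, because these expressions are unique up to equality in all models. -/
theorem IsLayered.map_funMap (hN : IsLayered T A ρ) {P : Type u} [L.Structure P]
    (hP : ∀ e ∈ T, ∀ a : ℕ → P, e.1.realize a = e.2.realize a) (φ : N → P)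
    (hφ : ∀ a ∈ A, ∃ s : L.Term {z : N // z ∉ A}, s.realize Subtype.val = a ∧
      s.realize (fun z => φ z.1) = φ a) {k : ℕ} (f : L.Functions k) (xs : Fin k → N) :
    φ (funMap f xs) = funMap f fun i => φ (xs i) := by
  have hφ' : ∀ a, ∃ s : L.Term {z : N // z ∉ A}, s.realize Subtype.val = a ∧
      s.realize (fun z => φ z.1) = φ a := by
    intro a
    by_cases ha : a ∈ A
    · exact hφ a ha
    · exact ⟨Term.var ⟨a, ha⟩, rfl, rfl⟩
  choose s hs hsφ using hφ'
  have h := hN.semEq (s (funMap f xs)) (Term.func f fun i => s (xs i))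
    (by simp only [Term.realize_func, hs]) ⟨P, hP⟩ fun z => φ z.1
  simpa only [Term.realize_func, hsφ] using h

theorem IsLayered.realize_mem (hN : IsLayered T A ρ) (m : ℕ) {ι : Type*} (s : L.Term ι)
    (v : ι → N) (hv : ∀ i, (v i ∈ A → ρ (v i) ≤ m + 1) ∧ (v i ∉ A → ρ (v i) ≤ m)) :
    (s.realize v ∈ A → ρ (s.realize v) ≤ m + 1) ∧ (s.realize v ∉ A → ρ (s.realize v) ≤ m) := by
  induction s with
  | var i => exact hv i
  | func f ts ih => exact hN.funMap_mem m f _ ih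

/-- If a homomorphism raises ranks below that of `a ∈ A` by at most `d`, then it raises the rank of
`a` by at most `d`, and by less unless it keeps `a` in `A`. -/
theorem IsLayered.rank_map_aux (hN : IsLayered T A ρ) {g : N → N}
    (hg : ∀ {k : ℕ} (f : L.Functions k) (xs : Fin k → N), g (funMap f xs) = funMap f (g ∘ xs))
    {a : N} (ha : a ∈ A) (h0 : ρ a ≠ 0) {d : ℕ} (hd : ∀ z, ρ z < ρ a → ρ (g z) ≤ ρ z + d) :
    (g a ∈ A → ρ (g a) ≤ ρ a + d) ∧ (g a ∉ A → ρ (g a) < ρ a + d) := by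
  obtain ⟨s, hs⟩ := hN.exists_term a ha
  obtain ⟨m, hm⟩ := Nat.exists_eq_succ_of_ne_zero h0
  have hreal : ∀ t : L.Term {z : N // z ∉ A ∧ ρ z < ρ a},
      g (t.realize Subtype.val) = t.realize fun z => g z.1 := by
    intro t
    induction t with
    | var z => rfl
    | func f ts ih => exact (hg f _).trans (congrArg _ (funext ih))
  have h1 := hN.realize_mem (m + d) s (fun z => g z.1) fun z => by
    have h2 := hd z.1 z.2.2
    have h3 := z.2.2
    exact ⟨fun _ => by omega, fun _ => by omega⟩
  rw [← hreal, hs] at h1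
  exact ⟨fun h => by have := h1.1 h; omega, fun h => by have := h1.2 h; omega⟩

/-- Operations applied to distinct generators of one rank leave the region generated by lower
ranks. -/
theorem IsLayered.lt_rank_funMap (hN : IsLayered T A ρ) {k : ℕ} {f : L.Functions k}
    (hc : ¬ IsConstantIn T f) (hp : ¬ IsProjectionIn T f) {z : Fin k → N}
    (hz : Function.Injective z) {r : ℕ} (hzA : ∀ i, z i ∉ A) (hr : ∀ i, ρ (z i) = r) :
    funMap f z ∈ A ∧ r < ρ (funMap f z) := by
  let z' : Fin k → {w : N // w ∉ A} := fun i => ⟨z i, hzA i⟩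
  have hz' : Function.Injective z' := fun i j h => hz (congrArg Subtype.val h)
  have hA : funMap f z ∈ A := by
    by_contra hA
    exact not_semEq_var hc hp hz' ⟨_, hA⟩ (hN.semEq _ _ rfl)
  refine ⟨hA, ?_⟩
  by_contra hlt
  obtain ⟨s, hs⟩ := hN.exists_term _ hA
  refine not_semEq_of_not_isConstantIn hc hz' s (fun w => ⟨w.1, w.2.1⟩) (fun w i h => hlt ?_)
    (hN.semEq _ _ ?_)
  · have h1 : w.1 = z i := congrArg Subtype.val h
    have h2 := w.2.2
    rwa [h1, hr] at h2
  · rw [Term.realize_relabel]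
    exact hs.symm

end Layered

/-! ### Free models of the sum, in layers -/

section Bilayered

variable {L₁ L₂ : FirstOrder.Language.{u, v}} {T₁ : EqTheory L₁} {T₂ : EqTheory L₂}
  {N : Type u} [L₁.Structure N] [L₂.Structure N] {A₁ A₂ : Set N} {ρ : N → ℕ}

/-- Layered structures for `T₁` and `T₂` on one set, with the same rank.  The elements of rank zero
are generators for both theories; an element of positive rank is a generator for exactly one. -/
structure IsBilayered (T₁ : EqTheory L₁) (T₂ : EqTheory L₂) (A₁ A₂ : Set N) (ρ : N → ℕ) :
    Prop where
  left : IsLayered T₁ A₁ ρ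
  right : IsLayered T₂ A₂ ρ
  disjoint : ∀ a ∈ A₁, a ∉ A₂
  rank_ne_zero : ∀ a, a ∈ A₁ ∨ a ∈ A₂ → ρ a ≠ 0
  mem_or_mem : ∀ a, ρ a ≠ 0 → a ∈ A₁ ∨ a ∈ A₂

theorem IsBilayered.symm (h : IsBilayered T₁ T₂ A₁ A₂ ρ) : IsBilayered T₂ T₁ A₂ A₁ ρ where
  left := h.right
  right := h.left
  disjoint a ha ha' := h.disjoint a ha' ha
  rank_ne_zero a ha := h.rank_ne_zero a ha.symm
  mem_or_mem a ha := (h.mem_or_mem a ha).symm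

/-- A doubly layered structure is free on its elements of rank zero. -/
theorem IsBilayered.exists_hom [L₁.IsAlgebraic] [L₂.IsAlgebraic]
    (h : IsBilayered T₁ T₂ A₁ A₂ ρ)
    (P : Model (EqTheory.sum T₁ T₂)) (φ₀ : N → P.carrier) :
    ∃ φ : N →[L₁.sum L₂] P.carrier, ∀ a, ρ a = 0 → φ a = φ₀ a := by
  classical
  let _ : L₁.Structure P.carrier := (LHom.sumInl : L₁ →ᴸ L₁.sum L₂).reduct P.carrier
  let _ : L₂.Structure P.carrier := (LHom.sumInr : L₂ →ᴸ L₁.sum L₂).reduct P.carrier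
  choose s₁ hs₁ using h.left.exists_term
  choose s₂ hs₂ using h.right.exists_term
  -- Evaluate the expressions recursively along the rank.
  let F : (a : N) → ((z : N) → ρ z < ρ a → P.carrier) → P.carrier := fun a φ =>
    if ha : a ∈ A₁ then (s₁ a ha).realize fun z => φ z.1 z.2.2
    else if ha : a ∈ A₂ then (s₂ a ha).realize fun z => φ z.1 z.2.2
    else φ₀ a
  let φ : N → P.carrier := (measure ρ).wf.fix F
  have hφ : ∀ a, φ a = F a fun z _ => φ z := (measure ρ).wf.fix_eq F
  have hφ₁ : ∀ {k : ℕ} (f : L₁.Functions k) (xs : Fin k → N), φ (funMap f xs) =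
      funMap f fun i => φ (xs i) := by
    refine fun f xs => h.left.map_funMap P.sat_left φ (fun a ha => ?_) f xs
    refine ⟨(s₁ a ha).relabel fun z => ⟨z.1, z.2.1⟩, ?_, ?_⟩
    · rw [Term.realize_relabel]; exact hs₁ a ha
    · rw [Term.realize_relabel, hφ a]
      simp only [F, dif_pos ha]
      rfl
  have hφ₂ : ∀ {k : ℕ} (f : L₂.Functions k) (xs : Fin k → N), φ (funMap f xs) =
      funMap f fun i => φ (xs i) := by
    refine fun f xs => h.right.map_funMap P.sat_right φ (fun a ha => ?_) f xs
    refine ⟨(s₂ a ha).relabel fun z => ⟨z.1, z.2.1⟩, ?_, ?_⟩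
    · rw [Term.realize_relabel]; exact hs₂ a ha
    · rw [Term.realize_relabel, hφ a]
      simp only [F, dif_neg fun ha' => h.disjoint a ha' ha, dif_pos ha]
      rfl
  let _ : (L₁.sum L₂).Structure P.carrier := P.str
  refine ⟨⟨φ, ?_, fun r => isEmptyElim r⟩, fun a ha => ?_⟩
  · rintro k (f | f) xs
    · exact hφ₁ f xs
    · exact hφ₂ f xs
  · refine (hφ a).trans ?_
    exact (dif_neg fun h' => h.rank_ne_zero a (Or.inl h') ha).trans
      (dif_neg fun h' => h.rank_ne_zero a (Or.inr h') ha)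

/-- An endomorphism that raises the rank of the elements of rank zero by at most `d` raises all
ranks by at most `d`. -/
theorem IsBilayered.rank_map_le (h : IsBilayered T₁ T₂ A₁ A₂ ρ) {g : N → N}
    (hg₁ : ∀ {k : ℕ} (f : L₁.Functions k) (xs : Fin k → N), g (funMap f xs) = funMap f (g ∘ xs))
    (hg₂ : ∀ {k : ℕ} (f : L₂.Functions k) (xs : Fin k → N), g (funMap f xs) = funMap f (g ∘ xs))
    {d : ℕ} (hd : ∀ a, ρ a = 0 → ρ (g a) ≤ d) (a : N) : ρ (g a) ≤ ρ a + d := by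
  induction hr : ρ a using Nat.strong_induction_on generalizing a with
  | _ r ih =>
  subst hr
  by_cases h0 : ρ a = 0
  · exact (hd a h0).trans (Nat.le_add_left _ _)
  rcases h.mem_or_mem a h0 with ha | ha
  · by_cases hga : g a ∈ A₁
    · exact (h.left.rank_map_aux hg₁ ha h0 fun z hz => ih _ hz z rfl).1 hga
    · exact ((h.left.rank_map_aux hg₁ ha h0 fun z hz => ih _ hz z rfl).2 hga).le
  · by_cases hga : g a ∈ A₂
    · exact (h.right.rank_map_aux hg₂ ha h0 fun z hz => ih _ hz z rfl).1 hga
    · exact ((h.right.rank_map_aux hg₂ ha h0 fun z hz => ih _ hz z rfl).2 hga).le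

/-- An endomorphism raises the rank less than `IsBilayered.rank_map_le` allows where it changes the
outermost layer. -/
theorem IsBilayered.rank_map_lt (h : IsBilayered T₁ T₂ A₁ A₂ ρ) {g : N → N}
    (hg₁ : ∀ {k : ℕ} (f : L₁.Functions k) (xs : Fin k → N), g (funMap f xs) = funMap f (g ∘ xs))
    (hg₂ : ∀ {k : ℕ} (f : L₂.Functions k) (xs : Fin k → N), g (funMap f xs) = funMap f (g ∘ xs))
    {d : ℕ} (hd : ∀ a, ρ a = 0 → ρ (g a) ≤ d) {a : N} (ha : a ∈ A₂) (hga : g a ∉ A₂) :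
    ρ (g a) < ρ a + d :=
  (h.right.rank_map_aux hg₂ ha (h.rank_ne_zero a (Or.inr ha))
    fun z _ => h.rank_map_le hg₁ hg₂ hd z).2 hga

/-- Suppose that an injective map `p` commutes with an operation `f` of `L₁`, and with the
endomorphisms that fix all elements of rank zero outside the range of `x`.  Then `p` does not send
`x 0` to an element whose outermost layer belongs to `T₂`: otherwise `f (p (x 0), …, p (x (k-1)))`
has an additional outermost layer, belonging to `T₁`, whereas the equal element
`p (f (x 0, …, x (k-1)))` arises from `p (x 0)` by substituting for `x 0` an element of rank at
most one. -/
theorem IsBilayered.map_notMem [L₁.IsAlgebraic] [L₂.IsAlgebraic]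
    (h : IsBilayered T₁ T₂ A₁ A₂ ρ) {k : ℕ} {f : L₁.Functions k} (hc : ¬ IsConstantIn T₁ f)
    (hp : ¬ IsProjectionIn T₁ f) {x : ℕ → N} (hx : Function.Injective x) (hx0 : ∀ i, ρ (x i) = 0)
    {p : N → N} (hpinj : Function.Injective p)
    (hpf : ∀ xs : Fin k → N, p (funMap f xs) = funMap f (p ∘ xs))
    (hpg : ∀ g : N →[L₁.sum L₂] N, (∀ a, ρ a = 0 → a ∉ Set.range x → g a = a) →
      ∀ a, p (g a) = g (p a)) :
    p (x 0) ∉ A₂ := by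
  classical
  intro hz0
  have hext : ∀ φ₀ : N → N, ∃ φ : N →[L₁.sum L₂] N, ∀ a, ρ a = 0 → φ a = φ₀ a :=
    h.exists_hom (sumModel h.left.sat h.right.sat)
  have hg₁ : ∀ (g : N →[L₁.sum L₂] N) {k : ℕ} (f : L₁.Functions k) (xs : Fin k → N),
      g (funMap f xs) = funMap f (g ∘ xs) := fun g _ f xs => g.map_fun (Sum.inl f) xs
  have hg₂ : ∀ (g : N →[L₁.sum L₂] N) {k : ℕ} (f : L₂.Functions k) (xs : Fin k → N),
      g (funMap f xs) = funMap f (g ∘ xs) := fun g _ f xs => g.map_fun (Sum.inr f) xs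
  -- The images of all `x i` look alike, because the `x i` can be permuted.
  have hswap : ∀ i, p (x i) ∈ A₂ ∧ ρ (p (x i)) = ρ (p (x 0)) := by
    intro i
    obtain ⟨g, hg⟩ := hext (Equiv.swap (x 0) (x i))
    have hfix : ∀ a, ρ a = 0 → a ∉ Set.range x → g a = a := fun a ha hax => by
      rw [hg a ha]
      exact Equiv.swap_apply_of_ne_of_ne (fun h => hax ⟨0, h.symm⟩) fun h => hax ⟨i, h.symm⟩
    have hd : ∀ a, ρ a = 0 → ρ (g a) ≤ 0 := by
      intro a ha
      rw [hg a ha]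
      rw [Equiv.swap_apply_def]
      split_ifs <;> simp only [ha, hx0, le_refl]
    have h1 : g (p (x 0)) = p (x i) := by
      rw [← hpg g hfix, hg _ (hx0 0), Equiv.swap_apply_left]
    have h2 : g (p (x i)) = p (x 0) := by
      rw [← hpg g hfix, hg _ (hx0 i), Equiv.swap_apply_right]
    have h3 := h.rank_map_le (hg₁ g) (hg₂ g) hd (p (x 0))
    have h4 := h.rank_map_le (hg₁ g) (hg₂ g) hd (p (x i))
    rw [h1] at h3
    rw [h2] at h4
    refine ⟨?_, le_antisymm h3 h4⟩
    by_contra hi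
    have h5 := h.rank_map_lt (hg₁ g) (hg₂ g) hd hz0 (h1 ▸ hi)
    rw [h1] at h5
    omega
  obtain ⟨g, hg⟩ := hext (Function.update id (x 0) (funMap f fun i : Fin k => x i))
  have hfix : ∀ a, ρ a = 0 → a ∉ Set.range x → g a = a := fun a ha hax => by
    rw [hg a ha, Function.update_of_ne fun h => hax ⟨0, h.symm⟩]
    rfl
  have hfx : ρ (funMap f fun i : Fin k => x i) ≤ 1 := by
    have h1 := h.left.funMap_mem 0 f (fun i : Fin k => x i)
      fun i => ⟨fun _ => (hx0 i).le.trans zero_le_one, fun _ => (hx0 i).le⟩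
    by_cases h2 : (funMap f fun i : Fin k => x i) ∈ A₁
    · exact h1.1 h2
    · exact (h1.2 h2).trans zero_le_one
  have hd : ∀ a, ρ a = 0 → ρ (g a) ≤ 1 := by
    intro a ha
    rw [hg a ha]
    by_cases hax : a = x 0
    · rw [hax, Function.update_self]
      exact hfx
    · rw [Function.update_of_ne hax, id, ha]
      exact zero_le_one
  have h1 : g (p (x 0)) = funMap f fun i : Fin k => p (x i) := by
    rw [← hpg g hfix, hg _ (hx0 0), Function.update_self, hpf]
    rfl
  have h2 := h.left.lt_rank_funMap hc hp (z := fun i : Fin k => p (x i))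
    (fun i j hij => Fin.val_injective (hx (hpinj hij)))
    (fun i hi => h.disjoint _ hi (hswap i).1) (fun i => (hswap i).2)
  rw [← h1] at h2
  have h3 := h.rank_map_lt (hg₁ g) (hg₂ g) hd hz0 (h.disjoint _ h2.1)
  omega

/-- A map as in `IsBilayered.map_notMem`, for operations of both theories, fixes `x 0`. -/
theorem IsBilayered.map_eq [L₁.IsAlgebraic] [L₂.IsAlgebraic]
    (h : IsBilayered T₁ T₂ A₁ A₂ ρ) {k₁ k₂ : ℕ} {f₁ : L₁.Functions k₁} {f₂ : L₂.Functions k₂}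
    (hc₁ : ¬ IsConstantIn T₁ f₁) (hp₁ : ¬ IsProjectionIn T₁ f₁)
    (hc₂ : ¬ IsConstantIn T₂ f₂) (hp₂ : ¬ IsProjectionIn T₂ f₂)
    {x : ℕ → N} (hx : Function.Injective x) (hx0 : ∀ i, ρ (x i) = 0)
    {p : N →[L₁.sum L₂] N} (hpinj : Function.Injective p)
    (hpg : ∀ g : N →[L₁.sum L₂] N, (∀ a, ρ a = 0 → a ∉ Set.range x → g a = a) →
      ∀ a, p (g a) = g (p a)) :
    p (x 0) = x 0 := by
  classical
  have hmem₂ := h.map_notMem hc₁ hp₁ hx hx0 hpinj (p.map_fun (Sum.inl f₁)) hpg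
  have hmem₁ := h.symm.map_notMem hc₂ hp₂ hx hx0 hpinj (p.map_fun (Sum.inr f₂)) fun g hg a =>
    hpg ⟨g, fun {n} f xs => by
      rcases f with f | f
      · exact g.map_fun (Sum.inr f) xs
      · exact g.map_fun (Sum.inl f) xs, fun r => isEmptyElim r⟩ hg a
  have h0 : ρ (p (x 0)) = 0 := by
    by_contra h0
    exact (h.mem_or_mem _ h0).elim hmem₁ hmem₂
  -- An endomorphism that sends `x 0` to `x 1` and fixes the other elements of rank zero shows
  -- `p (x 1) = p (x 0)` unless `p (x 0) = x 0`.
  by_contra hne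
  obtain ⟨g, hg⟩ : ∃ φ : N →[L₁.sum L₂] N, ∀ a, ρ a = 0 → φ a = Function.update id (x 0) (x 1) a :=
    h.exists_hom (sumModel h.left.sat h.right.sat) _
  have h1 := hpg g (fun a ha hax => by
    rw [hg a ha, Function.update_of_ne fun h => hax ⟨0, h.symm⟩]
    rfl) (x 0)
  rw [hg _ (hx0 0), Function.update_self, hg _ h0, Function.update_of_ne hne] at h1
  exact one_ne_zero (hx (hpinj h1))

end Bilayered

/-! ### Existence of a layered free model -/

section Existence

variable {L₁ L₂ : FirstOrder.Language.{u, v}} {T₁ : EqTheory L₁} {T₂ : EqTheory L₂}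

/-- On `K × ℕ × Bool`, with `K` infinite and at least as large as both signatures, there is a
bilayered structure whose rank is the middle coordinate; the last one names the
theory of the outermost layer of an element of positive rank. -/
theorem exists_isBilayered {k₁ k₂ : ℕ} {f₁ : L₁.Functions k₁} {f₂ : L₂.Functions k₂}
    (hc₁ : ¬ IsConstantIn T₁ f₁) (hp₁ : ¬ IsProjectionIn T₁ f₁)
    (hc₂ : ¬ IsConstantIn T₂ f₂) (hp₂ : ¬ IsProjectionIn T₂ f₂) (K : Type u) [Infinite K]
    (hK₁ : Cardinal.mk (Σ l, L₁.Functions l) ≤ Cardinal.mk K)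
    (hK₂ : Cardinal.mk (Σ l, L₂.Functions l) ≤ Cardinal.mk K) :
    ∃ (_ : L₁.Structure (K × ℕ × Bool)) (_ : L₂.Structure (K × ℕ × Bool)),
      IsBilayered T₁ T₂ {a : K × ℕ × Bool | a.2.1 ≠ 0 ∧ a.2.2 = true}
        {a | a.2.1 ≠ 0 ∧ a.2.2 = false} (fun a => a.2.1) := by
  have hN : Cardinal.mk (K × ℕ × Bool) ≤ Cardinal.mk K := by
    rw [Cardinal.mk_prod, Cardinal.lift_uzero]
    refine (Cardinal.mul_le_max_of_aleph0_le_left (Cardinal.aleph0_le_mk K)).trans ?_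
    refine max_le le_rfl (le_trans ?_ (Cardinal.aleph0_le_mk K))
    rw [Cardinal.lift_le_aleph0]
    exact Cardinal.mk_le_aleph0
  have hG : ∀ (b : Bool) (m : ℕ), Cardinal.mk K ≤ Cardinal.mk {z : K × ℕ × Bool //
      z ∉ {a : K × ℕ × Bool | a.2.1 ≠ 0 ∧ a.2.2 = b} ∧ z.2.1 = m} := fun b m =>
    Cardinal.mk_le_of_injective (f := fun c => ⟨(c, m, !b), fun h => by simpa using h.2, rfl⟩)
      fun c d h => congrArg (fun x => x.1.1) h
  have hA : ∀ (b : Bool) (m : ℕ), Cardinal.mk K ≤ Cardinal.mk {z : K × ℕ × Bool //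
      z ∈ {a : K × ℕ × Bool | a.2.1 ≠ 0 ∧ a.2.2 = b} ∧ z.2.1 = m + 1} := fun b m =>
    Cardinal.mk_le_of_injective
      (f := fun c => ⟨(c, m + 1, b), ⟨Nat.succ_ne_zero m, rfl⟩, rfl⟩)
      fun c d h => congrArg (fun x => x.1.1) h
  obtain ⟨S₁, h₁⟩ := exists_isLayered hc₁ hp₁ (ρ := fun a => a.2.1) hK₁ hN (fun a ha => ha.1)
    (hG true) (hA true)
  obtain ⟨S₂, h₂⟩ := exists_isLayered hc₂ hp₂ (ρ := fun a => a.2.1) hK₂ hN (fun a ha => ha.1)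
    (hG false) (hA false)
  refine ⟨S₁, S₂, h₁, h₂, fun a ha ha' => ?_, fun a ha => ha.elim And.left And.left,
    fun a ha => ?_⟩
  · exact Bool.noConfusion (ha.2.symm.trans ha'.2)
  · cases hb : a.2.2
    · exact Or.inr ⟨ha, hb⟩
    · exact Or.inl ⟨ha, hb⟩

end Existence

/-! ### The isotropy group -/

section Isotropy

/-- A morphism of models, as a homomorphism of structures. -/
def Model.toHom {L : FirstOrder.Language.{u, v}} {T : EqTheory L} {M N : Model T} (h : M ⟶ N) :
    M.carrier →[L] N.carrier := h

theorem isotropy_naturality {C : Type*} [Category C] {M : C} (α : IsotropyGroup M) {N N' : C}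
    (h : M ⟶ N) (g : N ⟶ N') :
    g ≫ α.hom.app (Under.mk (h ≫ g)) = α.hom.app (Under.mk h) ≫ g :=
  α.hom.naturality (Under.homMk g : Under.mk h ⟶ Under.mk (h ≫ g))

variable {L₁ L₂ : FirstOrder.Language.{u, v}} [L₁.IsAlgebraic] [L₂.IsAlgebraic]

/-- Every element of the isotropy group of a free model of the sum has identity components. -/
theorem isotropy_app_eq_id (T₁ : EqTheory L₁) (T₂ : EqTheory L₂)
    (h₁ : ∃ (k : ℕ) (f : L₁.Functions k), 1 ≤ k ∧ ¬ IsConstantIn T₁ f ∧ ¬ IsProjectionIn T₁ f)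
    (h₂ : ∃ (k : ℕ) (f : L₂.Functions k), 1 ≤ k ∧ ¬ IsConstantIn T₂ f ∧ ¬ IsProjectionIn T₂ f)
    {n : ℕ} {M : Model (EqTheory.sum T₁ T₂)} {y : Fin n → M.carrier} (hM : IsFreeOn M y)
    (α : IsotropyGroup M) {P : Model (EqTheory.sum T₁ T₂)} (h : M ⟶ P) :
    α.hom.app (Under.mk h) = 𝟙 P := by
  classical
  obtain ⟨k₁, f₁, -, hc₁, hp₁⟩ := h₁
  obtain ⟨k₂, f₂, -, hc₂, hp₂⟩ := h₂
  let K : Type u := ((Σ l, L₁.Functions l) ⊕ (Σ l, L₂.Functions l)) ⊕ ULift.{u} ℕ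
  obtain ⟨S₁, S₂, hN⟩ := exists_isBilayered hc₁ hp₁ hc₂ hp₂ K
    (Cardinal.mk_le_of_injective (f := fun a => Sum.inl (Sum.inl a))
      (Sum.inl_injective.comp Sum.inl_injective))
    (Cardinal.mk_le_of_injective (f := fun a => Sum.inl (Sum.inr a))
      (Sum.inl_injective.comp Sum.inr_injective))
  let N : Model (EqTheory.sum T₁ T₂) := sumModel hN.left.sat hN.right.sat
  -- Two disjoint families of elements of rank zero.
  let x : ℕ → N.carrier := fun i => (Sum.inr ⟨i⟩, 0, true)
  let b : Fin n → N.carrier := fun i => (Sum.inr ⟨i⟩, 0, false)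
  have hx : Function.Injective x := fun i j hij => by
    have h1 : (Sum.inr ⟨i⟩ : K) = Sum.inr ⟨j⟩ := congrArg Prod.fst hij
    exact congrArg ULift.down (Sum.inr_injective h1)
  have hb : ∀ i, b i ∉ Set.range x := by
    rintro i ⟨j, hj⟩
    exact Bool.noConfusion (congrArg (fun a : K × ℕ × Bool => a.2.2) hj)
  obtain ⟨j, hj, -⟩ := hM N b
  let j' : M ⟶ N := j
  let p : N ⟶ N := α.hom.app (Under.mk j')
  have hcomp : ∀ (Q : Model (EqTheory.sum T₁ T₂)) (g : N ⟶ Q) (h : M ⟶ Q),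
      (∀ i, Model.toHom g (b i) = Model.toHom h (y i)) → j' ≫ g = h := by
    intro Q g h hgh
    obtain ⟨w, -, hw⟩ := hM Q fun i => Model.toHom h (y i)
    refine (hw (j' ≫ g) fun i => ?_).trans (hw h fun i => rfl).symm
    rw [← hgh, ← hj i]
    rfl
  have hpinj : Function.Injective (Model.toHom p) := by
    have hinv : p ≫ α.inv.app (Under.mk j') = 𝟙 N :=
      NatTrans.congr_app α.hom_inv_id (Under.mk j')
    have hleft : Function.LeftInverse
        (Model.toHom (α.inv.app (Under.mk j')))
        (Model.toHom p) := fun a =>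
      congrArg (fun g : N ⟶ N => Model.toHom g a) hinv
    exact hleft.injective
  have hpx : Model.toHom p (x 0) = x 0 := by
    refine hN.map_eq hc₁ hp₁ hc₂ hp₂ hx (fun _ => rfl) hpinj fun g hg a => ?_
    have h1 := isotropy_naturality α j' (show N ⟶ N from g)
    rw [hcomp N g j' fun i => (hg _ rfl (hb i)).trans (hj i).symm] at h1
    exact congrArg (fun g : N ⟶ N => Model.toHom g a) h1
  -- Any element `a` of `P` is the image of `x 0` under a homomorphism compatible with `h`.
  refine FirstOrder.Language.Hom.ext fun (a : P.carrier) => ?_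
  have hbinj : Function.Injective b := fun i j hij => by
    have h1 : (Sum.inr ⟨i⟩ : K) = Sum.inr ⟨j⟩ := congrArg Prod.fst hij
    exact Fin.ext (congrArg ULift.down (Sum.inr_injective h1))
  obtain ⟨g, hg⟩ := hN.exists_hom P (Function.extend b (fun i => Model.toHom h (y i)) fun _ => a)
  have hgb : ∀ i, g (b i) = Model.toHom h (y i) := fun i =>
    (hg (b i) rfl).trans (hbinj.extend_apply _ _ i)
  have hgx : g (x 0) = a := by
    have hz : ¬ ∃ i, b i = x 0 := by
      rintro ⟨i, hi⟩
      exact hb i ⟨0, hi.symm⟩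
    exact (hg (x 0) rfl).trans (Function.extend_apply' _ _ _ hz)
  have h1 := isotropy_naturality α j' (show N ⟶ P from g)
  rw [hcomp P g h hgb] at h1
  have h2 : (Model.toHom (α.hom.app (Under.mk h))) (g (x 0)) =
      g (Model.toHom p (x 0)) :=
    congrArg (fun g : N ⟶ P => Model.toHom g (x 0)) h1
  rw [hpx, hgx] at h2
  exact h2

end Isotropy

end EquationalTheories

open EquationalTheories in
theorem corollary1 {L₁ L₂ : FirstOrder.Language.{u, v}} [L₁.IsAlgebraic] [L₂.IsAlgebraic]
    (T₁ : EqTheory L₁) (T₂ : EqTheory L₂)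
    (h₁ : ∃ (k : ℕ) (f : L₁.Functions k), 1 ≤ k ∧ ¬ IsConstantIn T₁ f ∧ ¬ IsProjectionIn T₁ f)
    (h₂ : ∃ (k : ℕ) (f : L₂.Functions k), 1 ≤ k ∧ ¬ IsConstantIn T₂ f ∧ ¬ IsProjectionIn T₂ f)
    (n : ℕ) (M : Model (EqTheory.sum T₁ T₂)) (y : Fin n → M.carrier) (hM : IsFreeOn M y) :
    (∀ π : EndoFamily M,
      π.MemIsotropy ↔ ∀ ⦃N : Model (EqTheory.sum T₁ T₂)⦄ (h : M ⟶ N), π h = 𝟙 N) ∧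
    (∀ g : Aut M, IsCategoricalInner g ↔ g = Iso.refl M) := by
  refine ⟨fun π => ⟨?_, fun hπ => ⟨Iso.refl _, fun N h => (hπ h).symm⟩⟩, fun g => ⟨?_, ?_⟩⟩
  · rintro ⟨α, hα⟩ N h
    rw [← hα h]
    exact isotropy_app_eq_id T₁ T₂ h₁ h₂ hM α h
  · rintro ⟨α, hα⟩
    exact Iso.ext (hα.symm.trans (isotropy_app_eq_id T₁ T₂ h₁ h₂ hM α (𝟙 M)))
  · rintro rfl
    exact ⟨Iso.refl _, rfl⟩
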